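/- Fix a countably infinite set $\mathcal V$ of variables and let $\mathfrak S_f(\mathcal V)$ be the group of permutations of $\mathcal V$ that move only finitely many elements. A nominal set is a set with an action of $\mathfrak S_f(\mathcal V)$ in which every element $x$ has a finite support; $\mathrm{supp}(x)$ is the least one, and $z$ is fresh for $x$ if $z\notin\mathrm{supp}(x)$. A nominal set is orbit-finite if it has finitely many orbits. For a nominal set $X$, the abstraction $[\mathcal V]X$ is the quotient of $\mathcal V\times X$ that identifies $(v_1,x_1)$ and $(v_2,x_2)$ if $(v_1\,z)x_1=(v_2\,z)x_2$ for some $z\neq v_1,v_2$ fresh for $x_1,x_2$; the class of $(v,x)$ is written $\langle v\rangle x$. Let $L_\alpha X=\mathcal V+[\mathcal V]X+X\times X$, a functor on nominal sets and equivariant maps. A $\lambda$-tree is a finite or infinite rooted ordered tree whose leaves are labelled by variables and whose inner nodes are labelled by $\lambda x$ ($x\in\mathcal V$, one successor) or by $@$ (two successors). Two $\lambda$-trees are $\alpha$-equivalent if for every $n$ their truncations at level $n$ are $\alpha$-equivalent finite $\lambda$-terms. A $\lambda$-tree is rational if it has only finitely many subtrees (up to isomorphism). Let $\nu L_\alpha$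 be the nominal set of $\alpha$-equivalence classes $[t]$ of $\lambda$-trees $t$ with finitely many free variables, with the $L_\alpha$-coalgebra structure that decomposes trees at the root: $[x]\mapsto x$, $[\lambda x.t]\mapsto\langle x\rangle[t]$, $[s\,@\,t]\mapsto([s],[t])$. Let $\varrho L_\alpha\subseteq\nu L_\alpha$ be the union of the images of all $L_\alpha$-coalgebra homomorphisms into $\nu L_\alpha$ from coalgebras with orbit-finite carrier. **Theorem.** Let $a\colon X\to L_\alpha X$ be an $L_\alpha$-coalgebra (with $a$ equivariant) whose carrier $X$ is an orbit-finite nominal set. Then there is a unique $L_\alpha$-coalgebra homomorphism $a^\dagger\colon X\to\nu L_\alpha$, and for every $\mathrm{root}\in X$ the class $a^\dagger(\mathrm{root})$ lies in $\varrho L_\alpha$ and contains a rational $\lambda$-tree. -/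

import Mathlib

universe u v w

namespace LambdaNom

/-! ### Finite permutations and nominal sets -/

/-- The group of finite permutations of `V`: those moving only finitely many elements. -/
def finPermSubgroup (V : Type v) : Subgroup (Equiv.Perm V) where
  carrier := {π | {x | π x ≠ x}.Finite}
  one_mem' := by simp
  mul_mem' := by
    intro a b ha hb
    refine (ha.union hb).subset ?_
    intro x hx
    by_contra h
    simp only [Set.mem_union, Set.mem_ofPred_eq, not_or, not_not] at h
    exact hx (by rw [Equiv.Perm.mul_apply, h.2, h.1])
  inv_mem' := by
    intro a ha
    refine Set.Finite.subset ha ?_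
    intro x hx h
    exact hx (by rw [Equiv.Perm.inv_eq_iff_eq]; exact h.symm)

abbrev FinPerm (V : Type v) : Type v := ↥(finPermSubgroup V)

theorem FinPerm.smul_var {V : Type v} (π : FinPerm V) (x : V) : π • x = π.1 x := rfl

/-- The transposition `(x y)` as a finite permutation. -/
def swap {V : Type v} [DecidableEq V] (x y : V) : FinPerm V :=
  ⟨Equiv.swap x y, by
    refine Set.Finite.subset (Set.toFinite {x, y}) ?_
    intro z hz
    by_contra h
    simp only [Set.mem_insert_iff, Set.mem_singleton_iff, not_or] at h
    exact hz (Equiv.swap_apply_of_ne_of_ne h.1 h.2)⟩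

/-- A nominal set over the set `V` of variables: an action of the finite permutations of `V`
for which every element has a finite support. -/
class NominalSet (V : Type v) (X : Type u) extends MulAction (FinPerm V) X where
  exists_supports : ∀ x : X, ∃ S : Finset V, MulAction.Supports (FinPerm V) (S : Set V) x

/-- The least support `supp x`: the intersection of all finite sets supporting `x`. -/
def supp (V : Type v) {X : Type u} [MulAction (FinPerm V) X] (x : X) : Set V :=
  {y | ∀ S : Finset V, MulAction.Supports (FinPerm V) (S : Set V) x → y ∈ S}

/-- A nominal set is orbit-finite if it has only finitely many orbits. -/
def OrbitFinite (V : Type v) (X : Type u) [NominalSet V X] : Prop :=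
  Finite (MulAction.orbitRel.Quotient (FinPerm V) X)

set_option linter.unusedSectionVars false

section Swap

variable {V : Type v} [DecidableEq V]

theorem swap_smul_left (x y : V) : swap x y • x = y := Equiv.swap_apply_left x y

theorem swap_smul_right (x y : V) : swap x y • y = x := Equiv.swap_apply_right x y

theorem swap_smul_of_ne {x y z : V} (h1 : z ≠ x) (h2 : z ≠ y) : swap x y • z = z :=
  Equiv.swap_apply_of_ne_of_ne h1 h2

theorem mul_swap (π : FinPerm V) (x y : V) : π * swap x y = swap (π • x) (π • y) * π :=
  Subtype.ext (Equiv.mul_swap_eq_swap_mul π.1 x y)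

theorem smul_swap_smul {X : Type u} [MulAction (FinPerm V) X] (π : FinPerm V) (a b : V) (x : X) :
    π • swap a b • x = swap (π • a) (π • b) • π • x := by
  rw [smul_smul, mul_swap, mul_smul]

theorem swap_smul_eq_of_supports {X : Type u} [MulAction (FinPerm V) X] {S : Set V} {x : X}
    (hS : MulAction.Supports (FinPerm V) S x) {a b : V} (ha : a ∉ S) (hb : b ∉ S) :
    swap a b • x = x := by
  refine hS _ ?_
  intro c hc
  exact swap_smul_of_ne (fun h => ha (h ▸ hc)) (fun h => hb (h ▸ hc))

theorem supports_smul {X : Type u} [MulAction (FinPerm V) X] {S : Finset V} {x : X}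
    (hS : MulAction.Supports (FinPerm V) (S : Set V) x) (π : FinPerm V) :
    MulAction.Supports (FinPerm V) ((S.image (π • ·) : Finset V) : Set V) (π • x) := by
  intro g hg
  have : (π⁻¹ * g * π) • x = x := by
    refine hS _ ?_
    intro c hc
    have := hg (a := π • c) (by simpa using hc)
    rw [mul_smul, mul_smul, this, inv_smul_smul]
  rw [mul_smul, mul_smul, inv_smul_eq_iff] at this
  exact this

theorem smul_notMem_supp {X : Type u} [MulAction (FinPerm V) X] {a : V} {x : X}
    (h : a ∉ supp V x) (π : FinPerm V) : π • a ∉ supp V (π • x) := by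
  simp only [supp, Set.mem_ofPred_eq, not_forall] at h ⊢
  obtain ⟨S, hS, ha⟩ := h
  exact ⟨_, supports_smul hS π, by simpa using ha⟩

theorem notMem_supp_of_supports {X : Type u} [MulAction (FinPerm V) X] {S : Finset V} {a : V}
    {x : X} (hS : MulAction.Supports (FinPerm V) (S : Set V) x) (h : a ∉ S) : a ∉ supp V x :=
  fun h' => h (h' S hS)

theorem swap_smul_of_notMem_supp [Infinite V] {X : Type u} [MulAction (FinPerm V) X] {a b : V}
    {x : X} (ha : a ∉ supp V x) (hb : b ∉ supp V x) : swap a b • x = x := by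
  simp only [supp, Set.mem_ofPred_eq, not_forall] at ha hb
  obtain ⟨S, hS, ha⟩ := ha
  obtain ⟨T, hT, hb⟩ := hb
  by_cases hab : a = b
  · subst hab
    exact swap_smul_eq_of_supports hS ha ha
  obtain ⟨c, hc⟩ := Infinite.exists_notMem_finset (S ∪ T ∪ {a, b})
  simp only [Finset.mem_union, Finset.mem_insert, Finset.mem_singleton, not_or] at hc
  have h1 : swap a c • x = x := swap_smul_eq_of_supports hS ha hc.1.1
  have h2 : swap c b • x = x := swap_smul_eq_of_supports hT hc.1.2 hb
  have h3 := smul_swap_smul (swap a c) c b x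
  rw [swap_smul_right, swap_smul_of_ne (Ne.symm hab) (Ne.symm hc.2.2), h2, h1] at h3
  exact h3.symm

end Swap

theorem notMem_supp_map {V : Type v} {X : Type u} {Y : Type w} [NominalSet V X] [NominalSet V Y]
    (f : X →[FinPerm V] Y) {a : V} {x : X} (h : a ∉ supp V x) : a ∉ supp V (f x) := by
  simp only [supp, Set.mem_ofPred_eq, not_forall] at h ⊢
  obtain ⟨S, hS, ha⟩ := h
  exact ⟨S, fun g hg => by rw [← map_smul, hS g hg], ha⟩

/-! ### Basic nominal sets -/

instance (V : Type v) : NominalSet V V where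
  exists_supports x := ⟨{x}, fun _ h => h (by simp)⟩

instance (V : Type v) (X : Type u) (Y : Type w) [NominalSet V X] [NominalSet V Y] :
    NominalSet V (X ⊕ Y) where
  exists_supports := by
    rintro (x | y)
    · obtain ⟨S, hS⟩ := NominalSet.exists_supports (V := V) x
      exact ⟨S, fun g hg => congrArg Sum.inl (hS g hg)⟩
    · obtain ⟨S, hS⟩ := NominalSet.exists_supports (V := V) y
      exact ⟨S, fun g hg => congrArg Sum.inr (hS g hg)⟩

instance (V : Type v) (X : Type u) (Y : Type w) [NominalSet V X] [NominalSet V Y] :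
    NominalSet V (X × Y) where
  exists_supports := by
    classical
    rintro ⟨x, y⟩
    obtain ⟨S, hS⟩ := NominalSet.exists_supports (V := V) x
    obtain ⟨T, hT⟩ := NominalSet.exists_supports (V := V) y
    exact ⟨S ∪ T, fun g hg => Prod.ext
      (hS g fun a ha => hg (by simp at ha ⊢; exact Or.inl ha))
      (hT g fun a ha => hg (by simp at ha ⊢; exact Or.inr ha))⟩

/-! ### The abstraction functor -/

section Abstraction

variable (V : Type v) [DecidableEq V] [Infinite V]

/-- `(v₁, x₁) ∼ (v₂, x₂)` iff `(v₁ z) x₁ = (v₂ z) x₂` for some `z` fresh for `v₁, v₂, x₁, x₂`. -/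
def AbsRel {X : Type u} [MulAction (FinPerm V) X] (p q : V × X) : Prop :=
  ∃ z : V, z ≠ p.1 ∧ z ≠ q.1 ∧ z ∉ supp V p.2 ∧ z ∉ supp V q.2 ∧
    swap p.1 z • p.2 = swap q.1 z • q.2

variable {V}

theorem AbsRel.any {X : Type u} [MulAction (FinPerm V) X] {p q : V × X} (h : AbsRel V p q)
    {y : V} (h1 : y ≠ p.1) (h2 : y ≠ q.1) (h3 : y ∉ supp V p.2) (h4 : y ∉ supp V q.2) :
    swap p.1 y • p.2 = swap q.1 y • q.2 := by
  obtain ⟨z, z1, z2, z3, z4, hz⟩ := h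
  have := congrArg (swap z y • ·) hz
  simp only [smul_swap_smul (swap z y)] at this
  rwa [swap_smul_left, swap_smul_of_ne z1.symm h1.symm, swap_smul_of_ne z2.symm h2.symm,
    swap_smul_of_notMem_supp z3 h3, swap_smul_of_notMem_supp z4 h4] at this

variable (V)

def absSetoid (X : Type u) [NominalSet V X] : Setoid (V × X) where
  r := AbsRel V
  iseqv := by
    refine ⟨?_, ?_, ?_⟩
    · intro p
      obtain ⟨S, hS⟩ := NominalSet.exists_supports (V := V) p.2
      obtain ⟨z, hz⟩ := Infinite.exists_notMem_finset (S ∪ {p.1})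
      simp only [Finset.mem_union, Finset.mem_singleton, not_or] at hz
      exact ⟨z, hz.2, hz.2, notMem_supp_of_supports hS hz.1, notMem_supp_of_supports hS hz.1, rfl⟩
    · rintro p q ⟨z, z1, z2, z3, z4, hz⟩
      exact ⟨z, z2, z1, z4, z3, hz.symm⟩
    · intro p q r hpq hqr
      obtain ⟨S, hS⟩ := NominalSet.exists_supports (V := V) p.2
      obtain ⟨T, hT⟩ := NominalSet.exists_supports (V := V) q.2
      obtain ⟨U, hU⟩ := NominalSet.exists_supports (V := V) r.2
      obtain ⟨z, hz⟩ := Infinite.exists_notMem_finset (S ∪ T ∪ U ∪ {p.1, q.1, r.1})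
      simp only [Finset.mem_union, Finset.mem_insert, Finset.mem_singleton, not_or] at hz
      obtain ⟨⟨⟨zS, zT⟩, zU⟩, zp, zq, zr⟩ := hz
      have hp := notMem_supp_of_supports hS zS
      have hq := notMem_supp_of_supports hT zT
      have hr := notMem_supp_of_supports hU zU
      exact ⟨z, zp, zr, hp, hr, (hpq.any zp zq hp hq).trans (hqr.any zq zr hq hr)⟩

/-- The abstraction `[V]X` of a nominal set `X`. -/
def Abs (X : Type u) [NominalSet V X] : Type (max u v) := Quotient (absSetoid V X)

variable {V}

/-- The class `⟨x⟩y` of the pair `(x, y)` in `[V]Y`. -/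
def Abs.mk {X : Type u} [NominalSet V X] (x : V) (y : X) : Abs V X :=
  Quotient.mk (absSetoid V X) (x, y)

/-- The action `π · ⟨x⟩y = ⟨π x⟩(π · y)`. -/
instance {X : Type u} [NominalSet V X] : SMul (FinPerm V) (Abs V X) where
  smul π := Quotient.map (fun p => (π • p.1, π • p.2)) (by
    rintro p q ⟨z, z1, z2, z3, z4, hz⟩
    refine ⟨π • z, ?_, ?_, smul_notMem_supp z3 π, smul_notMem_supp z4 π, ?_⟩
    · exact fun h => z1 (smul_left_cancel π h)
    · exact fun h => z2 (smul_left_cancel π h)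
    · simp only [← smul_swap_smul, hz])

theorem Abs.smul_mk {X : Type u} [NominalSet V X] (π : FinPerm V) (x : V) (y : X) :
    π • Abs.mk x y = Abs.mk (π • x) (π • y) := rfl

instance (X : Type u) [NominalSet V X] : NominalSet V (Abs V X) where
  one_smul := by
    rintro ⟨x, y⟩
    exact (Abs.smul_mk 1 x y).trans (by rw [one_smul, one_smul]; rfl)
  mul_smul := by
    rintro π σ ⟨x, y⟩
    exact (Abs.smul_mk (π * σ) x y).trans (by rw [mul_smul, mul_smul]; rfl)
  exists_supports := by
    rintro ⟨x, y⟩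
    obtain ⟨S, hS⟩ := NominalSet.exists_supports (V := V) y
    refine ⟨S ∪ {x}, fun g hg => (Abs.smul_mk g x y).trans ?_⟩
    rw [hg (a := x) (by simp), hS g fun a ha => hg (by simp at ha ⊢; exact Or.inr ha)]
    rfl

/-- The action of the abstraction functor on equivariant maps: `⟨x⟩y ↦ ⟨x⟩(f y)`. -/
def Abs.map {X : Type u} {Y : Type w} [NominalSet V X] [NominalSet V Y]
    (f : X →[FinPerm V] Y) : Abs V X →[FinPerm V] Abs V Y where
  toFun := Quotient.map (fun p => (p.1, f p.2)) (by
    rintro p q ⟨z, z1, z2, z3, z4, hz⟩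
    refine ⟨z, z1, z2, notMem_supp_map f z3, notMem_supp_map f z4, ?_⟩
    simp only [← map_smul, hz])
  map_smul' := by
    rintro π ⟨x, y⟩
    exact congrArg (Abs.mk (π • x)) (map_smul f π y)

/-! ### The functor `L_α` on nominal sets and its coalgebras -/

variable (V)

/-- `L_α X = V + [V]X + X × X`. -/
abbrev LAlpha (X : Type u) [NominalSet V X] : Type (max u v) := V ⊕ (Abs V X ⊕ (X × X))

variable {V}

/-- The action of `L_α` on equivariant maps. -/
def LAlpha.map {X : Type u} {Y : Type w} [NominalSet V X] [NominalSet V Y]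
    (f : X →[FinPerm V] Y) : LAlpha V X →[FinPerm V] LAlpha V Y where
  toFun := Sum.map id (Sum.map (Abs.map f) (Prod.map f f))
  map_smul' := by
    rintro π (x | x | ⟨x, y⟩)
    · rfl
    · exact congrArg (Sum.inr ∘ Sum.inl) (map_smul (Abs.map f) π x)
    · exact congrArg (Sum.inr ∘ Sum.inr) (Prod.ext (map_smul f π x) (map_smul f π y))

/-- `f` is a homomorphism from the `L_α`-coalgebra `(X, a)` to the `L_α`-coalgebra `(Y, b)`. -/
def IsCoalgHom {X : Type u} {Y : Type w} [NominalSet V X] [NominalSet V Y]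
    (a : X →[FinPerm V] LAlpha V X) (b : Y →[FinPerm V] LAlpha V Y)
    (f : X →[FinPerm V] Y) : Prop :=
  ∀ x, b (f x) = LAlpha.map f (a x)

end Abstraction

/-! ### Finite λ-terms (with a stub for cut-off subtrees) and their α-equivalence -/

/-- λ-terms over `V` with an extra constant `stub`, marking where a tree was truncated. -/
inductive Term (V : Type v) : Type v
  | stub : Term V
  | var (x : V) : Term V
  | lam (x : V) (t : Term V) : Term V
  | app (s t : Term V) : Term V

namespace Term

variable {V : Type v}

/-- Rename all variables of a term, free, bound and binding. -/
def rename (f : V → V) : Term V → Term V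
  | stub => stub
  | var x => var (f x)
  | lam x t => lam (f x) (t.rename f)
  | app s t => app (s.rename f) (t.rename f)

instance : MulAction (FinPerm V) (Term V) where
  smul π t := t.rename (π • ·)
  one_smul t := by
    change t.rename (fun x => (1 : FinPerm V) • x) = t
    induction t <;> simp_all [rename]
  mul_smul π σ t := by
    change t.rename (fun x => (π * σ) • x) = (t.rename (fun x => σ • x)).rename (fun x => π • x)
    induction t <;> simp_all [rename, mul_smul]

theorem smul_stub (π : FinPerm V) : π • (stub : Term V) = stub := rfl
theorem smul_var (π : FinPerm V) (x : V) : π • var x = var (π • x) := rfl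
theorem smul_lam (π : FinPerm V) (x : V) (t : Term V) : π • lam x t = lam (π • x) (π • t) := rfl
theorem smul_app (π : FinPerm V) (s t : Term V) : π • app s t = app (π • s) (π • t) := rfl

variable [DecidableEq V]

/-- All variables occurring in a term, free, bound or binding. -/
def vars : Term V → Finset V
  | stub => ∅
  | var x => {x}
  | lam x t => insert x t.vars
  | app s t => s.vars ∪ t.vars

/-- The free variables of a term. -/
def fv : Term V → Finset V
  | stub => ∅
  | var x => {x}
  | lam x t => t.fv.erase x
  | app s t => s.fv ∪ t.fv

/-- α-equivalence of finite terms: `λx.s` and `λy.t` are α-equivalent if `s` and `t` become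
α-equivalent after renaming `x` and `y`, respectively, to one variable `z` occurring in neither
of the two abstractions. -/
inductive AlphaEq : Term V → Term V → Prop
  | stub : AlphaEq stub stub
  | var (x : V) : AlphaEq (var x) (var x)
  | lam {x y z : V} {s t : Term V} (hx : z ≠ x) (hy : z ≠ y) (hs : z ∉ s.vars) (ht : z ∉ t.vars)
      (h : AlphaEq (swap x z • s) (swap y z • t)) : AlphaEq (lam x s) (lam y t)
  | app {s t s' t' : Term V} (h : AlphaEq s s') (h' : AlphaEq t t') :
      AlphaEq (app s t) (app s' t')

theorem vars_smul (π : FinPerm V) (t : Term V) : (π • t).vars = t.vars.image (π • ·) := by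
  induction t with
  | stub => rfl
  | var x => simp [smul_var, vars]
  | lam x t ih => simp [smul_lam, vars, ih, Finset.image_insert]
  | app s t ihs iht => simp [smul_app, vars, ihs, iht, Finset.image_union]

theorem smul_mem_vars {π : FinPerm V} {x : V} {t : Term V} : π • x ∈ (π • t).vars ↔ x ∈ t.vars := by
  simp [vars_smul]

theorem fv_subset_vars (t : Term V) : t.fv ⊆ t.vars := by
  induction t with
  | stub => simp [fv, vars]
  | var x => simp [fv, vars]
  | lam x t ih => exact (Finset.erase_subset _ _).trans (ih.trans (Finset.subset_insert _ _))
  | app s t ihs iht => exact Finset.union_subset_union ihs iht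

theorem smul_congr {σ π : FinPerm V} {t : Term V} (h : ∀ x ∈ t.vars, σ • x = π • x) :
    σ • t = π • t := by
  induction t with
  | stub => rfl
  | var x => rw [smul_var, smul_var, h x (by simp [vars])]
  | lam x t ih =>
    rw [smul_lam, smul_lam, h x (by simp [vars]), ih fun y hy => h y (by simp [vars, hy])]
  | app s t ihs iht =>
    rw [smul_app, smul_app, ihs fun y hy => h y (by simp [vars, hy]),
      iht fun y hy => h y (by simp [vars, hy])]

theorem swap_smul_eq {a b : V} {t : Term V} (ha : a ∉ t.vars) (hb : b ∉ t.vars) :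
    swap a b • t = t := by
  conv_rhs => rw [← one_smul (FinPerm V) t]
  refine smul_congr fun x hx => ?_
  rw [one_smul]
  exact swap_smul_of_ne (fun h => ha (h ▸ hx)) (fun h => hb (h ▸ hx))

theorem swap_smul_swap_smul {x z c : V} {t : Term V} (hz : z ≠ x) (hc : c ≠ x)
    (hz' : z ∉ t.vars) (hc' : c ∉ t.vars) : swap z c • swap x z • t = swap x c • t := by
  rw [smul_swap_smul, swap_smul_left, swap_smul_of_ne hz.symm hc.symm, swap_smul_eq hz' hc']

theorem AlphaEq.smul {s t : Term V} (h : AlphaEq s t) (π : FinPerm V) :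
    AlphaEq (π • s) (π • t) := by
  induction h with
  | stub => exact .stub
  | var x => exact .var _
  | lam hx hy hs ht _ ih =>
    rw [smul_swap_smul, smul_swap_smul] at ih
    exact .lam (fun h => hx (smul_left_cancel π h)) (fun h => hy (smul_left_cancel π h))
      (fun h => hs (smul_mem_vars.1 h)) (fun h => ht (smul_mem_vars.1 h)) ih
  | app _ _ ih ih' => exact .app ih ih'

theorem AlphaEq.symm {s t : Term V} (h : AlphaEq s t) : AlphaEq t s := by
  induction h with
  | stub => exact .stub
  | var x => exact .var _
  | lam hx hy hs ht _ ih => exact .lam hy hx ht hs ih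
  | app _ _ ih ih' => exact .app ih ih'

/-- Two finite permutations that agree on the free variables rename to α-equivalent terms. -/
theorem alphaEq_smul_smul [Infinite V] (t : Term V) :
    ∀ {σ π : FinPerm V}, (∀ x ∈ t.fv, σ • x = π • x) → AlphaEq (σ • t) (π • t) := by
  induction t with
  | stub => intro σ π _; exact .stub
  | var x => intro σ π h; rw [smul_var, smul_var, h x (by simp [fv])]; exact .var _
  | lam x t ih =>
    intro σ π h
    obtain ⟨z, hz⟩ :=
      Infinite.exists_notMem_finset ((σ • t).vars ∪ (π • t).vars ∪ {σ • x, π • x})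
    simp only [Finset.mem_union, Finset.mem_insert, Finset.mem_singleton, not_or] at hz
    obtain ⟨⟨h1, h2⟩, h3, h4⟩ := hz
    refine .lam (z := z) h3 h4 h1 h2 ?_
    change AlphaEq (swap (σ • x) z • σ • t) (swap (π • x) z • π • t)
    rw [smul_smul, smul_smul]
    refine ih fun y hy => ?_
    rw [mul_smul, mul_smul]
    by_cases hyx : y = x
    · subst hyx; rw [swap_smul_left, swap_smul_left]
    · have hy' := fv_subset_vars t hy
      rw [swap_smul_of_ne (fun e => hyx (smul_left_cancel σ e))
          (fun e => h1 (by rw [← e]; exact smul_mem_vars.2 hy')),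
        swap_smul_of_ne (fun e => hyx (smul_left_cancel π e))
          (fun e => h2 (by rw [← e]; exact smul_mem_vars.2 hy'))]
      exact h y (by simp [fv, hyx, hy])
  | app s t ihs iht =>
    intro σ π h
    exact .app (ihs fun y hy => h y (by simp [fv, hy])) (iht fun y hy => h y (by simp [fv, hy]))

theorem AlphaEq.refl [Infinite V] (t : Term V) : AlphaEq t t := by
  simpa using alphaEq_smul_smul t (σ := 1) (π := 1) fun _ _ => rfl

theorem AlphaEq.trans [Infinite V] {s t : Term V} (h : AlphaEq s t) :
    ∀ {r : Term V}, AlphaEq t r → AlphaEq s r := by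
  induction h with
  | stub => exact fun h => h
  | var x => exact fun h => h
  | app _ _ ih ih' => rintro _ (_ | _ | _ | ⟨h, h'⟩); exact .app (ih h) (ih' h')
  | @lam x y z s t hx hy hs ht _ ih =>
    intro r hr
    cases hr with
    | @lam _ u w _ r hy' hu ht' hr hh =>
    obtain ⟨c, hc⟩ := Infinite.exists_notMem_finset
      (s.vars ∪ t.vars ∪ r.vars ∪ {x, y, u, z, w})
    simp only [Finset.mem_union, Finset.mem_insert, Finset.mem_singleton, not_or] at hc
    obtain ⟨⟨⟨cs, ct⟩, cr⟩, cx, cy, cu, cz, cw⟩ := hc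
    have h1 := hh.smul (swap w c)
    rw [swap_smul_swap_smul hy' cy ht' ct, swap_smul_swap_smul hu cu hr cr] at h1
    have h2 := h1.smul (swap c z)
    rw [swap_smul_swap_smul cy hy ct ht] at h2
    have h3 := (ih h2).smul (swap z c)
    have e : swap z c * swap c z = 1 := Subtype.ext (by
      change Equiv.swap z c * Equiv.swap c z = 1
      rw [Equiv.swap_comm c z, Equiv.swap_mul_self])
    rw [swap_smul_swap_smul hx cx hs cs, smul_smul (swap z c), e, one_smul] at h3
    exact .lam cx cu cs cr h3

end Term

/-! ### λ-trees -/

/-- The labels of the nodes of λ-trees. -/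
inductive Label (V : Type v) : Type v
  | var (x : V) : Label V
  | lam (x : V) : Label V
  | app : Label V

/-- The set of successors of a node with a given label. -/
def Label.Arity {V : Type v} : Label V → Type
  | var _ => Empty
  | lam _ => Unit
  | app => Bool

/-- `Λ^∞`: all finite and infinite λ-trees over `V`, i.e. rooted ordered trees whose leaves are
labelled by variables, and whose inner nodes are labelled by `λx` with one successor or by `@` with
two successors. -/
def LTree (V : Type v) : Type v := PFunctor.M ⟨Label V, Label.Arity⟩

namespace LTree

variable {V : Type v}

/-- The single-node tree labelled by `x`. -/
def var (x : V) : LTree V := PFunctor.M.mk ⟨.var x, Empty.elim⟩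

def lam (x : V) (t : LTree V) : LTree V := PFunctor.M.mk ⟨.lam x, fun _ => t⟩

def app (s t : LTree V) : LTree V := PFunctor.M.mk ⟨.app, fun b => bif b then t else s⟩

/-- Decomposition of a tree at its root. -/
def out (t : LTree V) : V ⊕ ((V × LTree V) ⊕ (LTree V × LTree V)) :=
  match PFunctor.M.dest t with
  | ⟨.var x, _⟩ => .inl x
  | ⟨.lam x, f⟩ => .inr (.inl (x, f ()))
  | ⟨.app, f⟩ => .inr (.inr (f false, f true))

theorem out_var (x : V) : (var x).out = .inl x := rfl
theorem out_lam (x : V) (t : LTree V) : (lam x t).out = .inr (.inl (x, t)) := rfl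
theorem out_app (s t : LTree V) : (app s t).out = .inr (.inr (s, t)) := rfl

/-- Every tree is a variable, an abstraction or an application. -/
theorem exists_form (t : LTree V) :
    (∃ x, t = var x) ∨ (∃ x s, t = lam x s) ∨ (∃ r s, t = app r s) := by
  induction t using PFunctor.M.casesOn' with
  | f a f =>
  cases a with
  | var x => exact Or.inl ⟨x, congrArg (fun g => PFunctor.M.mk ⟨_, g⟩) (funext fun e => e.elim)⟩
  | lam x => exact Or.inr (Or.inl ⟨x, f (), rfl⟩)
  | app =>
    refine Or.inr (Or.inr ⟨f false, f true, congrArg (fun g => PFunctor.M.mk ⟨_, g⟩) ?_⟩)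
    funext b
    cases b <;> rfl

/-- The tree unfolding of a coalgebra for the set functor `V + V × A + A × A`. -/
def unravel {A : Type u} (c : A → V ⊕ ((V × A) ⊕ (A × A))) (a : A) : LTree V :=
  PFunctor.M.corec (F := ⟨Label V, Label.Arity⟩) (fun a =>
    match c a with
    | .inl x => ⟨.var x, Empty.elim⟩
    | .inr (.inl (x, b)) => ⟨.lam x, fun _ => b⟩
    | .inr (.inr (b, b')) => ⟨.app, fun i => bif i then b' else b⟩) a

theorem out_unravel {A : Type u} (c : A → V ⊕ ((V × A) ⊕ (A × A))) (a : A) :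
    (unravel c a).out = Sum.map id
      (Sum.map (Prod.map id (unravel c)) (Prod.map (unravel c) (unravel c))) (c a) := by
  unfold out unravel
  rw [PFunctor.M.dest_corec]
  rcases c a with x | ⟨x, b⟩ | ⟨b, b'⟩ <;> rfl

theorem out_injective : Function.Injective (out : LTree V → _) := by
  intro s t h
  rcases exists_form s with ⟨x, rfl⟩ | ⟨x, s, rfl⟩ | ⟨s, s', rfl⟩ <;>
  rcases exists_form t with ⟨y, rfl⟩ | ⟨y, t, rfl⟩ | ⟨t, t', rfl⟩ <;>
  simp_all [out_var, out_lam, out_app]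

/-- Rename all variables of a tree, both in leaves and in abstractions. -/
def rename (f : V → V) : LTree V → LTree V :=
  unravel fun t => Sum.map f (Sum.map (Prod.map f id) id) t.out

instance : SMul (FinPerm V) (LTree V) where
  smul π t := t.rename (π • ·)

theorem smul_var (π : FinPerm V) (x : V) : π • var x = var (π • x) :=
  out_injective (out_unravel _ _)
theorem smul_lam (π : FinPerm V) (x : V) (t : LTree V) : π • lam x t = lam (π • x) (π • t) :=
  out_injective (out_unravel _ _)
theorem smul_app (π : FinPerm V) (s t : LTree V) : π • app s t = app (π • s) (π • t) :=
  out_injective (out_unravel _ _)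

/-- The truncation of a tree at level `n`: every node at depth `n` is replaced by a stub. -/
def trunc : ℕ → LTree V → Term V
  | 0, _ => .stub
  | n + 1, t =>
    match t.out with
    | .inl x => .var x
    | .inr (.inl (x, s)) => .lam x (trunc n s)
    | .inr (.inr (r, s)) => .app (trunc n r) (trunc n s)

theorem trunc_var (n : ℕ) (x : V) : trunc (n + 1) (var x) = .var x := rfl
theorem trunc_lam (n : ℕ) (x : V) (t : LTree V) :
    trunc (n + 1) (lam x t) = .lam x (trunc n t) := rfl
theorem trunc_app (n : ℕ) (s t : LTree V) :
    trunc (n + 1) (app s t) = .app (trunc n s) (trunc n t) := rfl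

theorem trunc_smul (π : FinPerm V) (n : ℕ) (t : LTree V) : trunc n (π • t) = π • trunc n t := by
  induction n generalizing t with
  | zero => rfl
  | succ n ih =>
    rcases exists_form t with ⟨x, rfl⟩ | ⟨x, s, rfl⟩ | ⟨s, s', rfl⟩
    · rw [smul_var, trunc_var, trunc_var]; rfl
    · rw [smul_lam, trunc_lam, trunc_lam, ih]; rfl
    · rw [smul_app, trunc_app, trunc_app, ih, ih]; rfl

theorem ext_trunc {s t : LTree V} (h : ∀ n, trunc n s = trunc n t) : s = t := by
  refine PFunctor.M.bisim (P := ⟨Label V, Label.Arity⟩)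
    (fun s t => ∀ n, trunc n s = trunc n t) ?_ s t h
  intro s t h
  have h1 := h 1
  rcases exists_form s with ⟨x, rfl⟩ | ⟨x, s, rfl⟩ | ⟨s, s', rfl⟩ <;>
  rcases exists_form t with ⟨y, rfl⟩ | ⟨y, t, rfl⟩ | ⟨t, t', rfl⟩ <;>
  simp only [trunc_var, trunc_lam, trunc_app, Term.var.injEq, Term.lam.injEq, reduceCtorEq] at h1
  · subst h1
    exact ⟨_, _, _, rfl, rfl, fun i => i.elim⟩
  · obtain ⟨rfl, -⟩ := h1
    refine ⟨_, _, _, rfl, rfl, fun i n => ?_⟩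
    have := h (n + 1)
    rw [trunc_lam, trunc_lam, Term.lam.injEq] at this
    exact this.2
  · refine ⟨_, _, _, rfl, rfl, fun i n => ?_⟩
    have := h (n + 1)
    rw [trunc_app, trunc_app, Term.app.injEq] at this
    cases i
    · exact this.1
    · exact this.2

instance : MulAction (FinPerm V) (LTree V) where
  one_smul t := ext_trunc fun n => by rw [trunc_smul, one_smul]
  mul_smul π σ t := ext_trunc fun n => by rw [trunc_smul, trunc_smul, trunc_smul, mul_smul]

/-- `x` is free in `t`: some path from the root to an `x`-labelled leaf meets no label `λx`. -/
inductive IsFree (x : V) : LTree V → Prop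
  | var : IsFree x (var x)
  | lam {y : V} {t : LTree V} (hne : x ≠ y) (h : IsFree x t) : IsFree x (lam y t)
  | app_left {s t : LTree V} (h : IsFree x s) : IsFree x (app s t)
  | app_right {s t : LTree V} (h : IsFree x t) : IsFree x (app s t)

def freeVars (t : LTree V) : Set V := {x | IsFree x t}

/-- `Subtree s t`: the tree `s` is a subtree of `t`, i.e. the tree rooted at some node of `t`. -/
inductive Subtree (s : LTree V) : LTree V → Prop
  | refl : Subtree s s
  | lam {x : V} {t : LTree V} (h : Subtree s t) : Subtree s (lam x t)
  | app_left {t t' : LTree V} (h : Subtree s t) : Subtree s (app t t')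
  | app_right {t t' : LTree V} (h : Subtree s t') : Subtree s (app t t')

/-- A tree is rational if it has only finitely many subtrees. -/
def IsRational (t : LTree V) : Prop := {s | Subtree s t}.Finite

/-- Two trees are α-equivalent if all their truncations are α-equivalent. -/
def AlphaEq [DecidableEq V] (s t : LTree V) : Prop :=
  ∀ n, Term.AlphaEq (trunc n s) (trunc n t)

theorem fv_trunc_subset [DecidableEq V] (n : ℕ) (t : LTree V) {x : V} (hx : x ∈ (trunc n t).fv) :
    x ∈ t.freeVars := by
  induction n generalizing t with
  | zero => simp [trunc, Term.fv] at hx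
  | succ n ih =>
    rcases exists_form t with ⟨y, rfl⟩ | ⟨y, s, rfl⟩ | ⟨s, s', rfl⟩
    · simp only [trunc_var, Term.fv, Finset.mem_singleton] at hx
      subst hx
      exact .var
    · simp only [trunc_lam, Term.fv, Finset.mem_erase] at hx
      exact .lam hx.1 (ih s hx.2)
    · simp only [trunc_app, Term.fv, Finset.mem_union] at hx
      rcases hx with hx | hx
      · exact .app_left (ih s hx)
      · exact .app_right (ih s' hx)

theorem alphaEq_smul_smul [DecidableEq V] [Infinite V] {t : LTree V} {σ π : FinPerm V}
    (h : ∀ x ∈ t.freeVars, σ • x = π • x) : AlphaEq (σ • t) (π • t) := fun n => by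
  rw [trunc_smul, trunc_smul]
  exact Term.alphaEq_smul_smul _ fun x hx => h x (fv_trunc_subset n t hx)

theorem IsFree.smul {x : V} {t : LTree V} (h : IsFree x t) (π : FinPerm V) :
    IsFree (π • x) (π • t) := by
  induction h with
  | var => rw [smul_var]; exact .var
  | lam hne _ ih => rw [smul_lam]; exact .lam (fun e => hne (smul_left_cancel π e)) ih
  | app_left _ ih => rw [smul_app]; exact .app_left ih
  | app_right _ ih => rw [smul_app]; exact .app_right ih

theorem finite_freeVars_smul {t : LTree V} (h : t.freeVars.Finite) (π : FinPerm V) :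
    (π • t).freeVars.Finite := by
  refine (h.image (π • ·)).subset ?_
  intro x hx
  exact ⟨π⁻¹ • x, by
    have := IsFree.smul hx π⁻¹
    rwa [inv_smul_smul] at this, smul_inv_smul π x⟩

end LTree

/-! ### The coalgebra of λ-trees modulo α-equivalence -/

/-- The λ-trees with finitely many free variables. -/
def FfvTree (V : Type v) : Type v := {t : LTree V // t.freeVars.Finite}

theorem FfvTree.finite_left {V : Type v} {r s : LTree V} (h : (LTree.app r s).freeVars.Finite) :
    r.freeVars.Finite := h.subset fun _ hx => .app_left hx

theorem FfvTree.finite_right {V : Type v} {r s : LTree V} (h : (LTree.app r s).freeVars.Finite) :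
    s.freeVars.Finite := h.subset fun _ hx => .app_right hx

theorem LTree.finite_freeVars_of_lam {V : Type v} {x : V} {t : LTree V} (h : (lam x t).freeVars.Finite) :
    t.freeVars.Finite := by
  refine (h.union (Set.finite_singleton x)).subset ?_
  intro y hy
  by_cases hxy : y = x
  · exact Or.inr hxy
  · exact Or.inl (.lam hxy hy)

section Nu

variable (V : Type v) [DecidableEq V] [Infinite V]

def alphaSetoid : Setoid (FfvTree V) where
  r s t := LTree.AlphaEq s.1 t.1
  iseqv := ⟨fun _ _ => .refl _, fun h n => (h n).symm, fun h h' n => (h n).trans (h' n)⟩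

/-- The λ-trees with finitely many free variables modulo α-equivalence: the carrier of the final
`L_α`-coalgebra. -/
def NuLAlpha : Type v := Quotient (alphaSetoid V)

variable {V}

/-- The α-equivalence class of a λ-tree with finitely many free variables. -/
def NuLAlpha.mk (t : FfvTree V) : NuLAlpha V := Quotient.mk (alphaSetoid V) t

instance : SMul (FinPerm V) (NuLAlpha V) where
  smul π := Quotient.map (fun t => ⟨π • t.1, LTree.finite_freeVars_smul t.2 π⟩) (by
    intro s t h n
    have := (h n).smul π
    rwa [← LTree.trunc_smul, ← LTree.trunc_smul] at this)

theorem NuLAlpha.smul_mk (π : FinPerm V) (t : FfvTree V) :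
    π • mk t = mk ⟨π • t.1, LTree.finite_freeVars_smul t.2 π⟩ := rfl

theorem NuLAlpha.sound {s t : FfvTree V} (h : LTree.AlphaEq s.1 t.1) : mk s = mk t :=
  Quotient.sound h

theorem NuLAlpha.supports_mk (t : FfvTree V) (π : FinPerm V)
    (h : ∀ x ∈ t.1.freeVars, π • x = x) : π • mk t = mk t := by
  rw [smul_mk]
  refine sound ?_
  have := LTree.alphaEq_smul_smul (t := t.1) (σ := π) (π := 1) (by simpa using h)
  rwa [one_smul] at this

instance : NominalSet V (NuLAlpha V) where
  one_smul := by
    rintro ⟨t⟩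
    exact NuLAlpha.supports_mk t 1 (by simp)
  mul_smul := by
    rintro π σ ⟨t⟩
    exact congrArg NuLAlpha.mk (Subtype.ext (mul_smul π σ t.1))
  exists_supports := by
    rintro ⟨t⟩
    refine ⟨t.2.toFinset, fun π h => NuLAlpha.supports_mk t π fun x hx => h (by simpa using hx)⟩

theorem NuLAlpha.notMem_supp_mk {t : FfvTree V} {x : V} (h : x ∉ t.1.freeVars) :
    x ∉ supp V (mk t) := by
  refine notMem_supp_of_supports (S := t.2.toFinset) ?_ (by simpa using h)
  exact fun π h => NuLAlpha.supports_mk t π fun x hx => h (by simpa using hx)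

/-- The components of a tree at its root, modulo α-equivalence. -/
def FfvTree.str (t : FfvTree V) : LAlpha V (NuLAlpha V) :=
  match h : t.1.out with
  | .inl x => .inl x
  | .inr (.inl (x, s)) =>
    have e : t.1 = LTree.lam x s := LTree.out_injective h
    .inr (.inl (Abs.mk x (NuLAlpha.mk ⟨s, LTree.finite_freeVars_of_lam (e ▸ t.2)⟩)))
  | .inr (.inr (r, s)) =>
    have e : t.1 = LTree.app r s := LTree.out_injective h
    .inr (.inr (NuLAlpha.mk ⟨r, finite_left (e ▸ t.2)⟩, NuLAlpha.mk ⟨s, finite_right (e ▸ t.2)⟩))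

theorem FfvTree.str_var (x : V) (h) : FfvTree.str ⟨LTree.var x, h⟩ = .inl x := rfl

theorem FfvTree.str_lam (x : V) (s : LTree V) (h h') :
    FfvTree.str ⟨LTree.lam x s, h⟩ = .inr (.inl (Abs.mk x (NuLAlpha.mk ⟨s, h'⟩))) := rfl

theorem FfvTree.str_app (r s : LTree V) (h h' h'') :
    FfvTree.str ⟨LTree.app r s, h⟩ =
      .inr (.inr (NuLAlpha.mk ⟨r, h'⟩, NuLAlpha.mk ⟨s, h''⟩)) := rfl

theorem FfvTree.str_eq_of_alphaEq {s t : FfvTree V} (h : LTree.AlphaEq s.1 t.1) :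
    s.str = t.str := by
  obtain ⟨s, hs⟩ := s
  obtain ⟨t, ht⟩ := t
  change LTree.AlphaEq s t at h
  have h1 := h 1
  rcases LTree.exists_form s with ⟨x, rfl⟩ | ⟨x, s, rfl⟩ | ⟨s, s', rfl⟩ <;>
  rcases LTree.exists_form t with ⟨y, rfl⟩ | ⟨y, t, rfl⟩ | ⟨t, t', rfl⟩ <;>
  simp only [LTree.trunc_var, LTree.trunc_lam, LTree.trunc_app] at h1
  case inl.inl => cases h1; rfl
  case inr.inl.inr.inl =>
    have fs := LTree.finite_freeVars_of_lam hs
    have ft := LTree.finite_freeVars_of_lam ht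
    rw [str_lam x s hs fs, str_lam y t ht ft]
    refine congrArg (Sum.inr ∘ Sum.inl) (Quotient.sound ?_)
    obtain ⟨z, hz⟩ := Infinite.exists_notMem_finset (fs.toFinset ∪ ft.toFinset ∪ {x, y})
    simp only [Finset.mem_union, Finset.mem_insert, Finset.mem_singleton, not_or,
      Set.Finite.mem_toFinset] at hz
    obtain ⟨⟨zs, zt⟩, zx, zy⟩ := hz
    refine ⟨z, zx, zy, NuLAlpha.notMem_supp_mk zs, NuLAlpha.notMem_supp_mk zt, ?_⟩
    refine NuLAlpha.sound fun n => ?_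
    change Term.AlphaEq (LTree.trunc n (swap x z • s)) (LTree.trunc n (swap y z • t))
    rw [LTree.trunc_smul, LTree.trunc_smul]
    have key : ∀ (x w : V) (r : LTree V), z ∉ r.freeVars → z ≠ x → w ≠ x →
        w ∉ (LTree.trunc n r).vars →
        Term.AlphaEq (swap x z • LTree.trunc n r) (swap w z • swap x w • LTree.trunc n r) := by
      intro x w r hz hzx hwx hw
      rw [smul_smul]
      refine Term.alphaEq_smul_smul _ fun v hv => ?_
      rw [mul_smul]
      have vz : v ≠ z := fun e => hz (e ▸ LTree.fv_trunc_subset n r hv)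
      have vw : v ≠ w := fun e => hw (e ▸ Term.fv_subset_vars _ hv)
      by_cases hvx : v = x
      · subst hvx; rw [swap_smul_left, swap_smul_left, swap_smul_left]
      · rw [swap_smul_of_ne hvx vz, swap_smul_of_ne hvx vw, swap_smul_of_ne vw vz]
    have hn := h (n + 1)
    rw [LTree.trunc_lam, LTree.trunc_lam] at hn
    cases hn with
    | @lam _ _ w _ _ wx wy ws wt hh =>
    exact ((key x w s zs zx wx ws).trans (hh.smul (swap w z))).trans (key y w t zt zy wy wt).symm
  case inr.inr.inr.inr =>
    rw [str_app s s' hs (finite_left hs) (finite_right hs),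
      str_app t t' ht (finite_left ht) (finite_right ht)]
    refine congrArg (Sum.inr ∘ Sum.inr) (Prod.ext (NuLAlpha.sound fun n => ?_)
      (NuLAlpha.sound fun n => ?_))
    · have hn := h (n + 1)
      rw [LTree.trunc_app, LTree.trunc_app] at hn
      cases hn with | app h h' => exact h
    · have hn := h (n + 1)
      rw [LTree.trunc_app, LTree.trunc_app] at hn
      cases hn with | app h h' => exact h'
  all_goals cases h1

variable (V)

/-- The structure of the final `L_α`-coalgebra, decomposing (a representative of) a class of trees
at the root: `[x] ↦ x`, `[λx.t] ↦ ⟨x⟩[t]` and `[s @ t] ↦ ([s], [t])`. -/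
def NuLAlpha.str : NuLAlpha V →[FinPerm V] LAlpha V (NuLAlpha V) where
  toFun := Quotient.lift FfvTree.str fun _ _ h => FfvTree.str_eq_of_alphaEq h
  map_smul' := by
    rintro π ⟨t, ht⟩
    change FfvTree.str ⟨π • t, _⟩ = π • FfvTree.str ⟨t, ht⟩
    rcases LTree.exists_form t with ⟨x, rfl⟩ | ⟨x, s, rfl⟩ | ⟨s, s', rfl⟩
    · simp only [LTree.smul_var]; rfl
    · simp only [LTree.smul_lam]; rfl
    · simp only [LTree.smul_app]; rfl

/-- The rational fixpoint of `L_α`, as a subset of the final coalgebra: the union of the images of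
all homomorphisms from orbit-finite `L_α`-coalgebras into it. -/
def rationalFixpoint : Set (NuLAlpha V) :=
  {u | ∃ (C : Type v) (_ : NominalSet V C) (c : C →[FinPerm V] LAlpha V C)
    (h : C →[FinPerm V] NuLAlpha V),
    OrbitFinite V C ∧ IsCoalgHom c (NuLAlpha.str V) h ∧ u ∈ Set.range h}

end Nu

end LambdaNom

open LambdaNom

/-! A state of the coalgebra is unfolded level by level, and at each abstraction any representative
`⟨y⟩x'` may be chosen; `Unfolds` records all finite results. The choices do not matter: if `⟨y₁⟩x₁ =
⟨y₂⟩x₂`, then `(y₁ z)x₁ = (y₂ z)x₂` for fresh `z`, and unfolding is equivariant, so two unfoldings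
of one state to one level are α-equivalent (`Unfolds.alphaEq`). Their free variables lie in the
support of the state (`Unfolds.fv_subset_supp`).

Conversely, for a homomorphism `h`, every truncation of a representative of `h x` is α-equivalent to
an unfolding of `x` (`IsCoalgHom.exists_unfolds`). So any tree whose truncations unfold `x`
represents `h x` (`IsCoalgHom.mk_eq_of_unfolds`). This gives uniqueness. For existence, choose a
representative of every abstraction and take the infinite unfoldings (`exists_isCoalgHom`).

It remains to find a rational tree that unfolds a given state. Orbit-finiteness bounds the sizes of
supports by some `k`. Fix a set `W` of `k + 1` names containing the support of the root. A state
supported by `W` leaves a name of `W` outside its support, which can serve as the bound name; the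
state below the binder is again supported by `W` (`exists_isNaming_of_ncard_lt`). Only finitely many
states are supported by `W` (`OrbitFinite.finite_supp_subset`), so the resulting tree has finitely
many subtrees. -/

namespace LambdaNom

set_option linter.unusedSectionVars false

/-! ### Least supports -/

section Support

variable {V : Type v} [DecidableEq V]

/-- If `x` is fixed by all transpositions of elements outside `U`, then `U` supports `x`. -/
theorem supports_of_swap_smul {X : Type u} [MulAction (FinPerm V) X] {U : Set V} {x : X}
    (h : ∀ a b, a ∉ U → b ∉ U → swap a b • x = x) : MulAction.Supports (FinPerm V) U x := by
  -- Induction on a bound for the number of moved names. If `π` moves `v`, then composing with `(v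
  -- πv)` makes `v` a fixed point and moves no new name; both `v` and `πv` lie outside `U`, so this
  -- transposition fixes `x`.
  have key : ∀ (n : ℕ) (π : FinPerm V), {v | π.1 v ≠ v}.ncard ≤ n → (∀ v ∈ U, π • v = v) →
      π • x = x := by
    intro n
    induction n with
    | zero =>
      intro π hπ _
      have h0 : {v | π.1 v ≠ v} = ∅ :=
        (Set.ncard_eq_zero π.2).1 (Nat.le_zero.1 hπ)
      have : π = 1 := Subtype.ext (Equiv.ext fun v => by
        by_contra hv
        exact (h0 ▸ (show v ∈ {v | π.1 v ≠ v} from hv) : v ∈ (∅ : Set V)))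
      rw [this, one_smul]
    | succ n ih =>
      intro π hπ hU
      by_cases h1 : ∃ v, π.1 v ≠ v
      · obtain ⟨v, hv⟩ := h1
        have hvU : v ∉ U := fun hm => hv (hU v hm)
        have hvU' : π • v ∉ U := fun hm => hv (smul_left_cancel π (hU _ hm))
        have hlt : {w | (swap v (π • v) * π).1 w ≠ w}.ncard < {w | π.1 w ≠ w}.ncard := by
          refine Set.ncard_lt_ncard ?_ π.2
          refine (Set.ssubset_iff_of_subset ?_).2 ⟨v, hv, ?_⟩
          · intro w hw hw'
            change (swap v (π • v) * π) • w ≠ w at hw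
            change π • w = w at hw'
            rw [mul_smul, hw'] at hw
            refine hw (swap_smul_of_ne ?_ ?_)
            · rintro rfl; exact hv hw'
            · intro e
              have e' : π • w = π • v := hw'.trans e
              rw [smul_left_cancel π e'] at hw'
              exact hv hw'
          · intro hw
            refine hw ?_
            change (swap v (π • v) * π) • v = v
            rw [mul_smul, swap_smul_right]
        have := ih (swap v (π • v) * π) (by omega) (by
          intro w hw
          rw [mul_smul, hU w hw]
          exact swap_smul_of_ne (fun e => hvU (e ▸ hw)) (fun e => hvU' (e ▸ hw)))
        rw [mul_smul] at this
        have h2 := congrArg (swap v (π • v) • ·) this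
        have e : swap v (π • v) * swap v (π • v) = 1 :=
          Subtype.ext (Equiv.swap_mul_self v (π • v))
        simp only [smul_smul (swap v (π • v)) (swap v (π • v)), e, one_smul] at h2
        rw [h2, h v _ hvU hvU']
      · push Not at h1
        have : π = 1 := Subtype.ext (Equiv.ext h1)
        rw [this, one_smul]
  exact fun π hπ => key _ π le_rfl fun v hv => hπ hv

theorem supp_subset_of_supports {X : Type u} [MulAction (FinPerm V) X] {S : Finset V} {x : X}
    (hS : MulAction.Supports (FinPerm V) (S : Set V) x) : supp V x ⊆ S :=
  fun _ hy => hy S hS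

theorem finite_supp {X : Type u} [NominalSet V X] (x : X) : (supp V x).Finite := by
  obtain ⟨S, hS⟩ := NominalSet.exists_supports (V := V) x
  exact S.finite_toSet.subset (supp_subset_of_supports hS)

/-- That an intersection of finite supports still supports is seen on transpositions: two names
avoided by different supports can be exchanged by way of a third name avoided by both. -/
theorem supports_supp [Infinite V] {X : Type u} [MulAction (FinPerm V) X] (x : X) :
    MulAction.Supports (FinPerm V) (supp V x) x :=
  supports_of_swap_smul fun _ _ => swap_smul_of_notMem_supp

theorem smul_mem_supp_smul {X : Type u} [MulAction (FinPerm V) X] {π : FinPerm V} {y : V} {x : X} :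
    π • y ∈ supp V (π • x) ↔ y ∈ supp V x := by
  constructor
  · exact fun h => by_contra fun h' => smul_notMem_supp h' π h
  · intro h
    by_contra h'
    have := smul_notMem_supp h' π⁻¹
    rw [inv_smul_smul, inv_smul_smul] at this
    exact this h

theorem supp_smul {X : Type u} [MulAction (FinPerm V) X] (π : FinPerm V) (x : X) :
    supp V (π • x) = (π • ·) '' supp V x := by
  ext y
  constructor
  · intro hy
    exact ⟨π⁻¹ • y, smul_mem_supp_smul.1 (by rwa [smul_inv_smul]), smul_inv_smul π y⟩
  · rintro ⟨z, hz, rfl⟩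
    exact smul_mem_supp_smul.2 hz

theorem ncard_supp_smul {X : Type u} [MulAction (FinPerm V) X] (π : FinPerm V) (x : X) :
    (supp V (π • x)).ncard = (supp V x).ncard := by
  rw [supp_smul]
  exact Set.ncard_image_of_injective _ (MulAction.injective π)

theorem supp_map_subset {X : Type u} {Y : Type w} [NominalSet V X] [NominalSet V Y]
    (f : X →[FinPerm V] Y) (x : X) : supp V (f x) ⊆ supp V x :=
  fun _ h => by_contra fun h' => notMem_supp_map f h' h

theorem supp_subset_of_finite_of_supports [Infinite V] {X : Type u} [NominalSet V X] {S : Set V} {x : X}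
    (hf : S.Finite) (hS : MulAction.Supports (FinPerm V) S x) : supp V x ⊆ S := by
  have := supp_subset_of_supports (S := hf.toFinset) (x := x) (by simpa using hS)
  simpa using this

theorem mem_supp_var [Infinite V] (y : V) : y ∈ supp V y := by
  intro S hS
  by_contra h
  obtain ⟨z, hz⟩ := Infinite.exists_notMem_finset (insert y S)
  simp only [Finset.mem_insert, not_or] at hz
  have := swap_smul_eq_of_supports hS (a := y) (b := z) (by simpa using h) (by simpa using hz.2)
  rw [swap_smul_left] at this
  exact hz.1 this

theorem exists_fresh [Infinite V] {S : Set V} (hS : S.Finite) (T : Finset V) :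
    ∃ z, z ∉ S ∧ z ∉ T := by
  obtain ⟨z, hz⟩ := Infinite.exists_notMem_finset (hS.toFinset ∪ T)
  simp only [Finset.mem_union, not_or, Set.Finite.mem_toFinset] at hz
  exact ⟨z, hz⟩

end Support

/-! ### Freshness and abstraction -/

section AbsLemmas

variable {V : Type v} [DecidableEq V] [Infinite V]

/-- Turns the "some fresh `z`" of the definition into "every fresh `z`", so that `z` can also be
chosen to avoid the variables of given terms. -/
theorem Abs.swap_smul_eq_of_mk_eq {X : Type u} [NominalSet V X] {y y' z : V} {x x' : X}
    (h : Abs.mk y x = Abs.mk y' x') (h1 : z ≠ y) (h2 : z ≠ y') (h3 : z ∉ supp V x)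
    (h4 : z ∉ supp V x') : swap y z • x = swap y' z • x' :=
  AbsRel.any (p := (y, x)) (q := (y', x')) (Quotient.exact h) h1 h2 h3 h4

theorem Abs.mk_injective {X : Type u} [NominalSet V X] {y : V} {x x' : X}
    (h : Abs.mk y x = Abs.mk y x') : x = x' := by
  obtain ⟨z, hz, hzy⟩ := exists_fresh ((finite_supp x).union (finite_supp x')) {y}
  simp only [Set.mem_union, not_or, Finset.mem_singleton] at hz hzy
  exact smul_left_cancel _ (Abs.swap_smul_eq_of_mk_eq h hzy hzy hz.1 hz.2)

/-- A bound name can be renamed to a fresh one. -/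
theorem Abs.mk_eq_mk_swap {X : Type u} [NominalSet V X] {y z : V} {x : X} (hz : z ∉ supp V x) :
    Abs.mk y x = Abs.mk z (swap y z • x) := by
  by_cases hyz : z = y
  · subst hyz
    have : swap z z = 1 := Subtype.ext (Equiv.swap_self z)
    rw [this, one_smul]
  obtain ⟨w, hw, hw'⟩ := exists_fresh ((finite_supp x).union (finite_supp (swap y z • x))) {y, z}
  simp only [Set.mem_union, not_or, Finset.mem_singleton, Finset.mem_insert] at hw hw'
  refine Quotient.sound ⟨w, hw'.1, hw'.2, hw.1, hw.2, ?_⟩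
  change swap y w • x = swap z w • swap y z • x
  rw [smul_swap_smul, swap_smul_left, swap_smul_of_ne (Ne.symm hyz) (Ne.symm hw'.1),
    swap_smul_of_notMem_supp hz hw.1]

/-- A permutation fixing `y` and the support of `⟨y⟩x` fixes `⟨y⟩x`, and with the binder `y`
unchanged `Abs.mk_injective` makes it fix `x`. -/
theorem Abs.supp_subset_insert {X : Type u} [NominalSet V X] (y : V) (x : X) :
    supp V x ⊆ insert y (supp V (Abs.mk y x)) := by
  refine supp_subset_of_finite_of_supports ((finite_supp _).insert y) fun g hg => ?_
  refine Abs.mk_injective (y := y) ?_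
  have h := supports_supp (V := V) (Abs.mk y x) g fun v hv => hg (Set.mem_insert_of_mem y hv)
  rw [Abs.smul_mk, hg (Set.mem_insert y _)] at h
  exact h

/-- Freedom in choosing bound names: `w` need only avoid the support of the abstraction itself. This
lets a name be reused further down a branch once it is no longer in the support. -/
theorem Abs.exists_rep {X : Type u} [NominalSet V X] (p : Abs V X) {w : V} (hw : w ∉ supp V p) :
    ∃ x, p = Abs.mk w x := by
  obtain ⟨y, x⟩ := p
  change w ∉ supp V (Abs.mk y x) at hw
  change ∃ x', Abs.mk y x = _
  by_cases hwy : w = y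
  · exact ⟨x, hwy ▸ rfl⟩
  · refine ⟨_, Abs.mk_eq_mk_swap fun h => ?_⟩
    exact (Abs.supp_subset_insert y x h).elim hwy hw

/-- Equivariance of the injection gives only the reverse inclusion; this one comes from injectivity.
-/
theorem supp_inl {X : Type u} {Y : Type w} [NominalSet V X] [NominalSet V Y] (x : X) :
    supp V x ⊆ supp V (Sum.inl x : X ⊕ Y) :=
  supp_subset_of_finite_of_supports (finite_supp _) fun g hg =>
    Sum.inl_injective (supports_supp (V := V) (Sum.inl x : X ⊕ Y) g hg)

theorem supp_inr {X : Type u} {Y : Type w} [NominalSet V X] [NominalSet V Y] (y : Y) :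
    supp V y ⊆ supp V (Sum.inr y : X ⊕ Y) :=
  supp_subset_of_finite_of_supports (finite_supp _) fun g hg =>
    Sum.inr_injective (supports_supp (V := V) (Sum.inr y : X ⊕ Y) g hg)

theorem supp_fst_subset {X : Type u} {Y : Type w} [NominalSet V X] [NominalSet V Y] (p : X × Y) :
    supp V p.1 ⊆ supp V p :=
  supp_subset_of_finite_of_supports (finite_supp _) fun g hg =>
    congrArg Prod.fst (supports_supp (V := V) p g hg)

theorem supp_snd_subset {X : Type u} {Y : Type w} [NominalSet V X] [NominalSet V Y] (p : X × Y) :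
    supp V p.2 ⊆ supp V p :=
  supp_subset_of_finite_of_supports (finite_supp _) fun g hg =>
    congrArg Prod.snd (supports_supp (V := V) p g hg)

end AbsLemmas

/-! ### Orbit-finite nominal sets -/

section OrbitFinite

variable {V : Type v} [DecidableEq V] [Infinite V] {X : Type u} [NominalSet V X]

theorem exists_smul_out (x : X) : ∃ π : FinPerm V,
    π • (Quotient.out (Quotient.mk (MulAction.orbitRel (FinPerm V) X) x)) = x := by
  have h := Quotient.exact (Quotient.out_eq (Quotient.mk (MulAction.orbitRel (FinPerm V) X) x))
  exact MulAction.mem_orbit_iff.1 ((MulAction.orbitRel (FinPerm V) X).symm h)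

/-- The size of the support is constant on each orbit, and there are finitely many orbits. -/
theorem OrbitFinite.exists_ncard_supp_le (hX : OrbitFinite V X) :
    ∃ k, ∀ x : X, (supp V x).ncard ≤ k := by
  have : Finite (MulAction.orbitRel.Quotient (FinPerm V) X) := hX
  obtain ⟨k, hk⟩ := (Set.finite_range fun q : MulAction.orbitRel.Quotient (FinPerm V) X =>
    (supp V (Quotient.out q)).ncard).bddAbove
  refine ⟨k, fun x => ?_⟩
  obtain ⟨π, hπ⟩ := exists_smul_out (V := V) x
  rw [← hπ, ncard_supp_smul]
  exact hk ⟨_, rfl⟩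

/-- An orbit-finite nominal set has only finitely many elements over a finite set of names. -/
theorem OrbitFinite.finite_supp_subset (hX : OrbitFinite V X) {W : Set V} (hW : W.Finite) :
    {x : X | supp V x ⊆ W}.Finite := by
  have : Finite (MulAction.orbitRel.Quotient (FinPerm V) X) := hX
  -- Within one orbit, `π • x₀` is determined by the restriction of `π` to `supp x₀`, which maps
  -- into `W` when the support of `π • x₀` does; there are finitely many such maps. For a map that
  -- no `π` restricts to, the `epsilon` value is irrelevant.
  have horb : ∀ x₀ : X, {x : X | supp V x ⊆ W ∧ ∃ π : FinPerm V, π • x₀ = x}.Finite := by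
    intro x₀
    have := (finite_supp (V := V) x₀).to_subtype
    have := hW.to_subtype
    have : Nonempty X := ⟨x₀⟩
    refine Set.Finite.of_surjOn (s := Set.univ)
      (fun f : supp V x₀ → W => Classical.epsilon fun x : X =>
        ∃ π : FinPerm V, π • x₀ = x ∧ ∀ v, π • v.1 = (f v).1) ?_ Set.finite_univ
    rintro x ⟨hx, π, rfl⟩
    have hf : ∀ v : supp V x₀, π • v.1 ∈ W := fun v => hx (smul_mem_supp_smul.2 v.2)
    refine ⟨fun v => ⟨π • v.1, hf v⟩, Set.mem_univ _, ?_⟩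
    obtain ⟨σ, hσ, hσ'⟩ := Classical.epsilon_spec (p := fun x : X =>
      ∃ σ : FinPerm V, σ • x₀ = x ∧ ∀ v : supp V x₀, σ • v.1 = π • v.1) ⟨_, π, rfl, fun _ => rfl⟩
    refine hσ.symm.trans ?_
    have := supports_supp (V := V) x₀ (π⁻¹ * σ) fun v hv => by
      rw [mul_smul, hσ' ⟨v, hv⟩, inv_smul_smul]
    rwa [mul_smul, inv_smul_eq_iff] at this
  refine (Set.finite_iUnion fun q : MulAction.orbitRel.Quotient (FinPerm V) X =>
    horb (Quotient.out q)).subset fun x hx => ?_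
  exact Set.mem_iUnion.2 ⟨_, hx, exists_smul_out x⟩

/-- Needed because `rationalFixpoint` ranges only over carriers in the universe of `V`, while `X`
may live elsewhere. -/
theorem OrbitFinite.small (hX : OrbitFinite V X) : Small.{v} X := by
  have : Finite (MulAction.orbitRel.Quotient (FinPerm V) X) := hX
  have : Small.{v} (MulAction.orbitRel.Quotient (FinPerm V) X) := inferInstance
  refine small_of_surjective
    (f := fun p : FinPerm V × MulAction.orbitRel.Quotient (FinPerm V) X => p.1 • Quotient.out p.2)
    fun x => ?_
  obtain ⟨π, hπ⟩ := exists_smul_out (V := V) x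
  exact ⟨(π, _), hπ⟩

end OrbitFinite

/-! ### Finite unfoldings of a coalgebra -/

section Unfolding

variable {V : Type v} [DecidableEq V] [Infinite V] {X : Type u} [NominalSet V X]

/-- `Unfolds a n x t`: the term `t` arises by unfolding the state `x` of the coalgebra `a` down to
level `n`, with an arbitrary choice of bound names. -/
inductive Unfolds (a : X →[FinPerm V] LAlpha V X) : ℕ → X → Term V → Prop
  | stub (x : X) : Unfolds a 0 x .stub
  | var {n : ℕ} {x : X} {y : V} (h : a x = .inl y) : Unfolds a (n + 1) x (.var y)
  | lam {n : ℕ} {x x' : X} {y : V} {s : Term V} (h : a x = .inr (.inl (Abs.mk y x')))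
      (hs : Unfolds a n x' s) : Unfolds a (n + 1) x (.lam y s)
  | app {n : ℕ} {x x₁ x₂ : X} {s t : Term V} (h : a x = .inr (.inr (x₁, x₂)))
      (hs : Unfolds a n x₁ s) (ht : Unfolds a n x₂ t) : Unfolds a (n + 1) x (.app s t)

variable {a : X →[FinPerm V] LAlpha V X}

theorem Unfolds.smul {n : ℕ} {x : X} {t : Term V} (h : Unfolds a n x t) (π : FinPerm V) :
    Unfolds a n (π • x) (π • t) := by
  induction h with
  | stub x => exact .stub _
  | var h => exact .var ((map_smul a π _).trans (by rw [h]; rfl))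
  | lam h _ ih => exact .lam ((map_smul a π _).trans (by rw [h]; rfl)) ih
  | app h _ _ ih ih' => exact .app ((map_smul a π _).trans (by rw [h]; rfl)) ih ih'

/-- At an abstraction the two bodies unfold different states, but after swapping both bound names
with a common fresh `z` they unfold the same state, so the induction hypothesis applies. -/
theorem Unfolds.alphaEq {n : ℕ} : ∀ {x : X} {s t : Term V},
    Unfolds a n x s → Unfolds a n x t → Term.AlphaEq s t := by
  induction n with
  | zero =>
    intro x s t hs ht
    cases hs; cases ht
    exact .stub
  | succ n ih =>
    intro x s t hs ht
    cases hs with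
    | var h =>
      cases ht with
      | var h' => rw [h] at h'; cases h'; exact .var _
      | lam h' => rw [h] at h'; cases h'
      | app h' => rw [h] at h'; cases h'
    | @lam _ _ x₁ y s h hs =>
      cases ht with
      | var h' => rw [h] at h'; cases h'
      | @lam _ _ x₂ y' t h' ht =>
        rw [h] at h'
        have e : Abs.mk y x₁ = Abs.mk y' x₂ := Sum.inl_injective (Sum.inr_injective h')
        obtain ⟨z, hz, hz'⟩ := exists_fresh ((finite_supp (V := V) x₁).union (finite_supp x₂))
          (s.vars ∪ t.vars ∪ {y, y'})
        simp only [Set.mem_union, Finset.mem_union, Finset.mem_insert, Finset.mem_singleton,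
          not_or] at hz hz'
        obtain ⟨⟨zs, zt⟩, zy, zy'⟩ := hz'
        refine .lam zy zy' zs zt (ih (hs.smul _) ?_)
        rw [Abs.swap_smul_eq_of_mk_eq e zy zy' hz.1 hz.2]
        exact ht.smul _
      | app h' => rw [h] at h'; cases h'
    | app h hs₁ hs₂ =>
      cases ht with
      | var h' => rw [h] at h'; cases h'
      | lam h' => rw [h] at h'; cases h'
      | app h' ht₁ ht₂ => rw [h] at h'; cases h'; exact .app (ih hs₁ ht₁) (ih hs₂ ht₂)

/-- The bound name is the only one that the support can gain in passing below a binder, and exactly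
that name is removed from the free variables. -/
theorem Unfolds.fv_subset_supp {n : ℕ} {x : X} {t : Term V} (h : Unfolds a n x t) :
    (t.fv : Set V) ⊆ supp V x := by
  induction h with
  | stub x => simp [Term.fv]
  | @var n x y h =>
    intro v hv
    simp only [Term.fv, Finset.coe_singleton, Set.mem_singleton_iff] at hv
    subst hv
    refine supp_map_subset a x ?_
    rw [h]
    exact supp_inl _ (mem_supp_var v)
  | @lam n x x' y s h _ ih =>
    intro v hv
    simp only [Term.fv, Finset.coe_erase, Set.mem_sdiff, Set.mem_singleton_iff] at hv
    refine supp_map_subset a x ?_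
    rw [h]
    exact supp_inr _ (supp_inl _ ((Abs.supp_subset_insert y x' (ih hv.1)).resolve_left hv.2))
  | @app n x x₁ x₂ s t h _ _ ih ih' =>
    intro v hv
    simp only [Term.fv, Finset.coe_union, Set.mem_union] at hv
    refine supp_map_subset a x ?_
    rw [h]
    refine supp_inr _ (supp_inr _ ?_)
    exact hv.elim (fun hv => supp_fst_subset (x₁, x₂) (ih hv))
      (fun hv => supp_snd_subset (x₁, x₂) (ih' hv))

theorem LTree.IsFree.exists_mem_fv_trunc {x : V} {t : LTree V} (h : LTree.IsFree x t) :
    ∃ n, x ∈ (LTree.trunc n t).fv := by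
  induction h with
  | var => exact ⟨1, by simp [LTree.trunc_var, Term.fv]⟩
  | lam hne _ ih =>
    obtain ⟨n, hn⟩ := ih
    exact ⟨n + 1, by simp [LTree.trunc_lam, Term.fv, hne, hn]⟩
  | app_left _ ih =>
    obtain ⟨n, hn⟩ := ih
    exact ⟨n + 1, by simp [LTree.trunc_app, Term.fv, hn]⟩
  | app_right _ ih =>
    obtain ⟨n, hn⟩ := ih
    exact ⟨n + 1, by simp [LTree.trunc_app, Term.fv, hn]⟩

theorem freeVars_finite_of_unfolds {x : X} {t : LTree V}
    (h : ∀ n, Unfolds a n x (LTree.trunc n t)) : t.freeVars.Finite := by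
  refine (finite_supp (V := V) x).subset fun v hv => ?_
  obtain ⟨n, hn⟩ := LTree.IsFree.exists_mem_fv_trunc hv
  exact (h n).fv_subset_supp hn

/-- The set coalgebra `c` on `A` chooses names for the bound variables of the states `ι x`, `x : A`,
of the `L_α`-coalgebra `a`. -/
def IsNaming {A : Type w} (a : X →[FinPerm V] LAlpha V X) (ι : A → X)
    (c : A → V ⊕ ((V × A) ⊕ (A × A))) : Prop :=
  ∀ x, a (ι x) = Sum.map id (Sum.map (fun p => Abs.mk p.1 (ι p.2)) (Prod.map ι ι)) (c x)

theorem LTree.unravel_eq {A : Type w} (c : A → V ⊕ ((V × A) ⊕ (A × A))) (x : A) :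
    (∃ y, c x = .inl y ∧ unravel c x = var y) ∨
    (∃ y x', c x = .inr (.inl (y, x')) ∧ unravel c x = lam y (unravel c x')) ∨
    (∃ x₁ x₂, c x = .inr (.inr (x₁, x₂)) ∧
      unravel c x = app (unravel c x₁) (unravel c x₂)) := by
  have h := out_unravel c x
  rcases hc : c x with y | ⟨y, x'⟩ | ⟨x₁, x₂⟩
  · exact .inl ⟨y, rfl, out_injective (by rw [h, hc]; rfl)⟩
  · exact .inr (.inl ⟨y, x', rfl, out_injective (by rw [h, hc]; rfl)⟩)
  · exact .inr (.inr ⟨x₁, x₂, rfl, out_injective (by rw [h, hc]; rfl)⟩)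

theorem IsNaming.unfolds {A : Type w} {ι : A → X} {c : A → V ⊕ ((V × A) ⊕ (A × A))}
    (hc : IsNaming a ι c) (n : ℕ) : ∀ x, Unfolds a n (ι x) (LTree.trunc n (LTree.unravel c x)) := by
  induction n with
  | zero => exact fun x => .stub _
  | succ n ih =>
    intro x
    have h := hc x
    rcases LTree.unravel_eq c x with ⟨y, e, e'⟩ | ⟨y, x', e, e'⟩ | ⟨x₁, x₂, e, e'⟩ <;>
      rw [e] at h <;> rw [e']
    · exact .var h
    · exact .lam h (ih x')
    · exact .app h (ih x₁) (ih x₂)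

/-- Every subtree of an unravelling is the unravelling of some state. -/
theorem LTree.isRational_unravel {A : Type w} [Finite A] (c : A → V ⊕ ((V × A) ⊕ (A × A))) (x : A) :
    (unravel c x).IsRational := by
  refine (Set.finite_range (unravel c)).subset ?_
  intro s hs
  change Subtree s (unravel c x) at hs
  generalize ht : unravel c x = t at hs
  induction hs generalizing x with
  | refl => exact ⟨x, ht⟩
  | lam _ ih =>
    rcases unravel_eq c x with ⟨y, e, e'⟩ | ⟨y, x', e, e'⟩ | ⟨x₁, x₂, e, e'⟩ <;>
      have e₂ := congrArg out (e'.symm.trans ht) <;>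
      simp only [out_var, out_lam, out_app, reduceCtorEq, Sum.inr.injEq, Sum.inl.injEq,
        Prod.mk.injEq] at e₂
    exact ih x' e₂.2
  | app_left _ ih =>
    rcases unravel_eq c x with ⟨y, e, e'⟩ | ⟨y, x', e, e'⟩ | ⟨x₁, x₂, e, e'⟩ <;>
      have e₂ := congrArg out (e'.symm.trans ht) <;>
      simp only [out_var, out_lam, out_app, reduceCtorEq, Sum.inr.injEq,
        Prod.mk.injEq] at e₂
    exact ih x₁ e₂.1
  | app_right _ ih =>
    rcases unravel_eq c x with ⟨y, e, e'⟩ | ⟨y, x', e, e'⟩ | ⟨x₁, x₂, e, e'⟩ <;>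
      have e₂ := congrArg out (e'.symm.trans ht) <;>
      simp only [out_var, out_lam, out_app, reduceCtorEq, Sum.inr.injEq,
        Prod.mk.injEq] at e₂
    exact ih x₂ e₂.2

end Unfolding

/-! ### Homomorphisms into the coalgebra of λ-trees -/

section Hom

variable {V : Type v} [DecidableEq V] [Infinite V] {X : Type u} [NominalSet V X]
  {a : X →[FinPerm V] LAlpha V X}

theorem Term.AlphaEq.lam_congr {s t : Term V} (h : AlphaEq s t) (x : V) :
    AlphaEq (.lam x s) (.lam x t) := by
  obtain ⟨z, hz⟩ := Infinite.exists_notMem_finset (s.vars ∪ t.vars ∪ {x})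
  simp only [Finset.mem_union, Finset.mem_singleton, not_or] at hz
  exact .lam hz.2 hz.2 hz.1.1 hz.1.2 (h.smul _)

/-- The transposition `(x z)` fixes every free variable of `λx.t`, hence maps this term to an
α-equivalent one. -/
theorem Term.alphaEq_lam_swap {x z : V} {t : Term V} (hz : z ∉ t.fv) :
    AlphaEq (.lam z (swap x z • t)) (.lam x t) := by
  have := alphaEq_smul_smul (.lam x t) (σ := swap x z) (π := 1) (by
    intro v hv
    simp only [fv, Finset.mem_erase] at hv
    rw [one_smul]
    exact swap_smul_of_ne hv.1 fun e => hz (e ▸ hv.2))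
  rwa [one_smul, smul_lam, swap_smul_left] at this

theorem NuLAlpha.exists_mk (u : NuLAlpha V) : ∃ t, mk t = u := Quotient.exists_rep u

/-- The truncations of the values of a homomorphism are unfoldings of the given coalgebra. -/
theorem IsCoalgHom.exists_unfolds {h : X →[FinPerm V] NuLAlpha V}
    (hh : IsCoalgHom a (NuLAlpha.str V) h) (n : ℕ) : ∀ (x : X) (t : FfvTree V),
    NuLAlpha.mk t = h x → ∃ s, Unfolds a n x s ∧ Term.AlphaEq s (LTree.trunc n t.1) := by
  induction n with
  | zero => exact fun x t _ => ⟨_, .stub x, .stub⟩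
  | succ n ih =>
    rintro x ⟨t, ht⟩ hx
    have e := hh x
    rw [← hx] at e
    change FfvTree.str ⟨t, ht⟩ = _ at e
    rcases LTree.exists_form t with ⟨y, rfl⟩ | ⟨y, s, rfl⟩ | ⟨s, s', rfl⟩
    · rw [FfvTree.str_var] at e
      rcases hax : a x with y' | p | p <;> rw [hax] at e
      · cases (Sum.inl_injective e : y = y')
        exact ⟨_, .var hax, .var _⟩
      · cases e
      · cases e
    · have hs := LTree.finite_freeVars_of_lam ht
      rw [FfvTree.str_lam y s ht hs] at e
      rcases hax : a x with y' | p | p <;> rw [hax] at e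
      · cases e
      · obtain ⟨y', x'⟩ := p
        have e' : Abs.mk y (NuLAlpha.mk ⟨s, hs⟩) = Abs.mk y' (h x') :=
          Sum.inl_injective (Sum.inr_injective e)
        obtain ⟨z, hz, hz'⟩ := exists_fresh ((finite_supp (V := V) x').union
          (finite_supp (NuLAlpha.mk ⟨s, hs⟩))) ((LTree.trunc n s).vars ∪ {y, y'})
        simp only [Set.mem_union, Finset.mem_union, Finset.mem_insert, Finset.mem_singleton,
          not_or] at hz hz'
        -- The tree `(y z)s` represents the value of `h` at the state `(y' z)x'`. The induction
        -- hypothesis ranges over all states and representatives, so it applies to this pair.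
        have e₂ := Abs.swap_smul_eq_of_mk_eq e' hz'.2.1 hz'.2.2 hz.2 (notMem_supp_map h hz.1)
        rw [← map_smul] at e₂
        obtain ⟨r, hr, hr'⟩ := ih _ _ e₂
        -- The unfolding binds `z` instead of `y'`: `⟨y'⟩x' = ⟨z⟩(y' z)x'`.
        refine ⟨.lam z r, .lam (x' := swap y' z • x') (hax.trans ?_) hr, ?_⟩
        · exact congrArg (Sum.inr ∘ Sum.inl) (Abs.mk_eq_mk_swap hz.1)
        · change Term.AlphaEq r (LTree.trunc n (swap y z • s)) at hr'
          rw [LTree.trunc_smul] at hr'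
          exact (hr'.lam_congr z).trans
            (Term.alphaEq_lam_swap fun h => hz'.1 (Term.fv_subset_vars _ h))
      · cases e
    · have hs := FfvTree.finite_left ht
      have hs' := FfvTree.finite_right ht
      rw [FfvTree.str_app s s' ht hs hs'] at e
      rcases hax : a x with y' | p | p <;> rw [hax] at e
      · cases e
      · cases e
      · obtain ⟨x₁, x₂⟩ := p
        have e' : (NuLAlpha.mk ⟨s, hs⟩, NuLAlpha.mk ⟨s', hs'⟩) = (h x₁, h x₂) :=
          Sum.inr_injective (Sum.inr_injective e)
        obtain ⟨r, hr, hr'⟩ := ih _ _ (congrArg Prod.fst e')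
        obtain ⟨q, hq, hq'⟩ := ih _ _ (congrArg Prod.snd e')
        exact ⟨_, .app hax hr hq, .app hr' hq'⟩

/-- The condition on `t` does not involve `h`. One such tree for each state therefore forces
uniqueness, and a rational one settles rationality. -/
theorem IsCoalgHom.mk_eq_of_unfolds {h : X →[FinPerm V] NuLAlpha V}
    (hh : IsCoalgHom a (NuLAlpha.str V) h) {x : X} {t : FfvTree V}
    (ht : ∀ n, Unfolds a n x (LTree.trunc n t.1)) : NuLAlpha.mk t = h x := by
  obtain ⟨t', ht'⟩ := NuLAlpha.exists_mk (h x)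
  rw [← ht']
  refine NuLAlpha.sound fun n => ?_
  obtain ⟨s, hs, hs'⟩ := hh.exists_unfolds n x t' ht'
  exact ((ht n).alphaEq hs).trans hs'

variable (a) in
theorem exists_isNaming_id : ∃ c, IsNaming a id c := by
  have : ∀ x, ∃ p : V ⊕ ((V × X) ⊕ (X × X)),
      a x = Sum.map id (Sum.map (fun p => Abs.mk p.1 p.2) id) p := by
    intro x
    rcases a x with y | ⟨y, x'⟩ | p
    · exact ⟨.inl y, rfl⟩
    · exact ⟨.inr (.inl (y, x')), rfl⟩
    · exact ⟨.inr (.inr p), rfl⟩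
  choose c hc using this
  exact ⟨c, hc⟩

variable (a) in
-- The choice `c` of representatives need not be equivariant. Equivariance appears only modulo α:
-- the tree chosen for `π • x` and the renamed tree of `x` both unfold `π • x`.
theorem exists_isCoalgHom : ∃ h : X →[FinPerm V] NuLAlpha V, IsCoalgHom a (NuLAlpha.str V) h := by
  obtain ⟨c, hc⟩ := exists_isNaming_id a
  have hu : ∀ x n, Unfolds a n x (LTree.trunc n (LTree.unravel c x)) := fun x n => hc.unfolds n x
  let T : X → FfvTree V := fun x => ⟨LTree.unravel c x, freeVars_finite_of_unfolds (hu x)⟩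
  let h : X →[FinPerm V] NuLAlpha V :=
    { toFun := fun x => NuLAlpha.mk (T x)
      map_smul' := fun π x => NuLAlpha.sound fun n => by
        change Term.AlphaEq _ (LTree.trunc n (π • LTree.unravel c x))
        rw [LTree.trunc_smul]
        exact (hu _ n).alphaEq ((hu x n).smul π) }
  refine ⟨h, fun x => ?_⟩
  change FfvTree.str (T x) = _
  have hx := hc x
  rcases LTree.unravel_eq c x with ⟨y, e, e'⟩ | ⟨y, x', e, e'⟩ | ⟨x₁, x₂, e, e'⟩ <;>
    rw [e] at hx <;> change a x = _ at hx <;> rw [hx]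
  · have : T x = ⟨.var y, e' ▸ (T x).2⟩ := Subtype.ext e'
    rw [this]; rfl
  · have : T x = ⟨.lam y (LTree.unravel c x'), e' ▸ (T x).2⟩ := Subtype.ext e'
    rw [this]; rfl
  · have : T x = ⟨.app (LTree.unravel c x₁) (LTree.unravel c x₂), e' ▸ (T x).2⟩ := Subtype.ext e'
    rw [this]; rfl

/-! ### Rational trees from a finite stock of names -/

/-- If `W` has more names than the supports of all states, then the states supported by `W` can be
unfolded using only bound names from `W`. -/
theorem exists_isNaming_of_ncard_lt {W : Set V}
    (hk : ∀ x : X, (supp V x).ncard < W.ncard) (a : X →[FinPerm V] LAlpha V X) :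
    ∃ c, IsNaming a (Subtype.val : {x : X // supp V x ⊆ W} → X) c := by
  have : ∀ x : {x : X // supp V x ⊆ W},
      ∃ p : V ⊕ ((V × {x : X // supp V x ⊆ W}) ⊕
        ({x : X // supp V x ⊆ W} × {x : X // supp V x ⊆ W})),
      a x.1 = Sum.map id
        (Sum.map (fun p => Abs.mk p.1 p.2.1) (Prod.map Subtype.val Subtype.val)) p := by
    rintro ⟨x, hx⟩
    have hs := supp_map_subset a x
    rcases hax : a x with y | p | ⟨x₁, x₂⟩ <;> rw [hax] at hs
    · exact ⟨.inl y, rfl⟩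
    · have hp : supp V p ⊆ supp V x := fun v hv => hs (supp_inr _ (supp_inl _ hv))
      -- A spare name of `W` outside `supp x`, hence outside `supp p`, can bind `p`. The body is
      -- then supported by `supp p` together with `w`, so it stays over `W`.
      obtain ⟨w, hw, hwx⟩ := Set.exists_mem_notMem_of_ncard_lt_ncard (hk x) (finite_supp x)
      obtain ⟨x', rfl⟩ := Abs.exists_rep p fun h => hwx (hp h)
      refine ⟨.inr (.inl (w, ⟨x', ?_⟩)), rfl⟩
      exact (Abs.supp_subset_insert w x').trans (Set.insert_subset hw (hp.trans hx))
    · have hp : supp V (x₁, x₂) ⊆ supp V x := fun v hv => hs (supp_inr _ (supp_inr _ hv))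
      exact ⟨.inr (.inr (⟨x₁, (supp_fst_subset (x₁, x₂)).trans (hp.trans hx)⟩,
        ⟨x₂, (supp_snd_subset (x₁, x₂)).trans (hp.trans hx)⟩)), rfl⟩
  choose c hc using this
  exact ⟨c, hc⟩

theorem OrbitFinite.exists_rational_unfolding (hX : OrbitFinite V X)
    (a : X →[FinPerm V] LAlpha V X) (x : X) :
    ∃ t : LTree V, t.IsRational ∧ ∀ n, Unfolds a n x (LTree.trunc n t) := by
  obtain ⟨k, hk⟩ := hX.exists_ncard_supp_le
  -- `k + 1` names: one more than any support uses, so a binder always finds a spare one. Containing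
  -- `supp x` makes `x` itself one of the states over `W`.
  obtain ⟨W, hxW, hW⟩ := Infinite.exists_superset_card_eq (finite_supp (V := V) x).toFinset (k + 1)
    (by rw [← Set.ncard_eq_toFinset_card _ (finite_supp x)]; exact (hk x).trans (Nat.le_succ k))
  obtain ⟨c, hc⟩ := exists_isNaming_of_ncard_lt (W := (W : Set V))
    (fun x => by rw [Set.ncard_coe_finset, hW]; exact Nat.lt_succ_of_le (hk x)) a
  have : Finite {x : X // supp V x ⊆ (W : Set V)} :=
    (hX.finite_supp_subset W.finite_toSet).to_subtype
  have hx : supp V x ⊆ (W : Set V) := fun v hv => hxW (by simpa using hv)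
  exact ⟨_, LTree.isRational_unravel c ⟨x, hx⟩, fun n => hc.unfolds n ⟨x, hx⟩⟩

/-! ### Membership in the rational fixpoint, across universes -/

/-- The action transported along a bijection. -/
abbrev NominalSet.transport {C : Type w} (e : C ≃ X) : NominalSet V C :=
  { e.mulAction (FinPerm V) with
    exists_supports := fun x => by
      obtain ⟨S, hS⟩ := NominalSet.exists_supports (V := V) (e x)
      exact ⟨S, fun g hg => e.symm_apply_eq.2 (hS g hg)⟩ }

theorem LAlpha.map_map {Y : Type w} {Z : Type*} [NominalSet V Y] [NominalSet V Z]
    (f : X →[FinPerm V] Y) (g : Y →[FinPerm V] Z) (p : LAlpha V X) :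
    LAlpha.map g (LAlpha.map f p) = LAlpha.map (g.comp f) p := by
  rcases p with y | ⟨y, x⟩ | ⟨x₁, x₂⟩ <;> rfl

/-- The coalgebra `a` with the homomorphism `h` is itself the witness, up to replacing its carrier
by an isomorphic copy in the universe of `V`. -/
theorem OrbitFinite.mem_rationalFixpoint (hX : OrbitFinite V X) {h : X →[FinPerm V] NuLAlpha V}
    (hh : IsCoalgHom a (NuLAlpha.str V) h) (x : X) : h x ∈ rationalFixpoint V := by
  have := hX.small
  let e : Shrink.{v} X ≃ X := (equivShrink X).symm
  let _ : NominalSet V (Shrink.{v} X) := NominalSet.transport e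
  let f : Shrink.{v} X →[FinPerm V] X :=
    { toFun := e, map_smul' := fun π x => e.apply_symm_apply _ }
  let g : X →[FinPerm V] Shrink.{v} X :=
    { toFun := e.symm
      map_smul' := fun π x => congrArg (fun y => e.symm (π • y)) (e.apply_symm_apply x).symm }
  refine ⟨Shrink.{v} X, inferInstance, (LAlpha.map g).comp (a.comp f), h.comp f, ?_, ?_,
    e.symm x, congrArg h (e.apply_symm_apply x)⟩
  · have : Finite (MulAction.orbitRel.Quotient (FinPerm V) X) := hX
    refine Finite.of_surjective (Quotient.map g ?_ :
      MulAction.orbitRel.Quotient (FinPerm V) X → _) ?_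
    · rintro _ y ⟨π, rfl⟩
      exact ⟨π, (map_smul g π y).symm⟩
    · rintro ⟨y⟩
      exact ⟨Quotient.mk _ (f y), congrArg (Quotient.mk _) (e.symm_apply_apply y)⟩
  · intro y
    change NuLAlpha.str V (h (f y)) = LAlpha.map (h.comp f) (LAlpha.map g (a (f y)))
    have : (h.comp f).comp g = h := MulActionHom.ext fun x => congrArg h (e.apply_symm_apply x)
    rw [hh, LAlpha.map_map, this]

end Hom

end LambdaNom

/-! ### Unique homomorphism with rational representatives -/

theorem mainTheorem2 {V : Type v} [DecidableEq V] [Countable V] [Infinite V]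
    {X : Type u} [NominalSet V X] (hX : OrbitFinite V X) (a : X →[FinPerm V] LAlpha V X) :
    (∃! h : X →[FinPerm V] NuLAlpha V, IsCoalgHom a (NuLAlpha.str V) h) ∧
      ∀ h : X →[FinPerm V] NuLAlpha V, IsCoalgHom a (NuLAlpha.str V) h →
        ∀ root : X, h root ∈ rationalFixpoint V ∧
          ∃ t : FfvTree V, NuLAlpha.mk t = h root ∧ t.1.IsRational := by
  have hrep : ∀ x, ∃ t : FfvTree V, t.1.IsRational ∧ ∀ n, Unfolds a n x (LTree.trunc n t.1) := by
    intro x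
    obtain ⟨t, ht, hu⟩ := hX.exists_rational_unfolding a x
    exact ⟨⟨t, freeVars_finite_of_unfolds hu⟩, ht, hu⟩
  refine ⟨?_, fun h hh root => ⟨hX.mem_rationalFixpoint hh root, ?_⟩⟩
  · obtain ⟨h, hh⟩ := exists_isCoalgHom a
    -- Both homomorphisms send `x` to the class of one and the same tree unfolding `x`.
    refine ⟨h, hh, fun h' hh' => MulActionHom.ext fun x => ?_⟩
    obtain ⟨t, -, hu⟩ := hrep x
    rw [← hh.mk_eq_of_unfolds hu, ← hh'.mk_eq_of_unfolds hu]
  · obtain ⟨t, ht, hu⟩ := hrep root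
    exact ⟨t, hh.mk_eq_of_unfolds hu, ht⟩
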